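/- Setting. Let $T$ be the once-punctured torus (a torus with one boundary component), $x\in\partial T$, and let $G=\pi_1(T,x)$, the free group on $\alpha,\beta$, where $\gamma_0=\alpha\beta\alpha^{-1}\beta^{-1}$ is the class of the boundary loop. Let $M$ be an untwisted hyperbolic once-punctured torus bundle over the circle with monodromy fixing $\partial T$ pointwise, and let $h$ be the automorphism of $G$ induced by the monodromy. Thus $h(\gamma_0)=\gamma_0$, the induced matrix $h_+\in \mathrm{SL}(2,\mathbb Z)$ on $H_1(T;\mathbb Z)=\mathbb Z^2$ has trace $>2$, and $\pi_1(M)\cong G\rtimes_h\mathbb Z$. Write $\lambda,1/\lambda>0$ for the eigenvalues of $h_+$ and $(e_\lambda,e_{1/\lambda})$ for an eigenbasis of $\mathbb R^2$. A *positive cone* of a group $H$ is a subset $P$ with $PP\subset P$, $H=P\sqcup P^{-1}\sqcup\{1\}$ and $g^{-1}Pg=P$ for all $g\in H$; it defines the bi-order $a<b\iff a^{-1}b\in P$. A subgroup $C$ is *convex* if $a<g<b$ with $a,b\in C$ implies $g\in C$. A proper convex subgroup $C$ of $H$ is *maximal* if the only convex subgroups of $H$ containing $C$ are $C$ and $H$.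 A bi-order on $G$ is *standard* if every term of the lower central series of $G$ is convex. For $e\in\{\pm e_\lambda,\pm e_{1/\lambda}\}$, the set of $u\in\mathbb Z^2$ with $u\cdot e>0$ (dot product taken in the coordinates with respect to the eigenbasis) is a positive cone of $\mathbb Z^2$, preserved by $h_+$; let $\prec_e$ be the corresponding order ($u\prec_e v$ if and only if $(v-u)\cdot e>0$). Let $G_2=[G,G]$, let $p_1:G\to\mathbb Z^2$ be the abelianization map and $p_2:G_2\to G_2/[G_2,G_2]$ the quotient map. The group $G_2/[G_2,G_2]$ is $H_1(\hat T;\mathbb Z)$, where $\hat T$ is the cover of $T$ with group $G_2$; it is free abelian with basis $\mathcal B=\{\gamma_u : u\in\mathbb Z^2\}$ given by the boundary components of $\hat T$, where $\gamma_{(m,n)}=p_2(\alpha^m\beta^n\gamma_0(\alpha^m\beta^n)^{-1})$. Order $\mathcal B$ by $\gamma_u<_e\gamma_v\iff u\prec_e v$. For a non-zero $v\in G_2/[G_2,G_2]$ let $\max(v)$ be the $<_e$-largest element of $\mathcal B$ that has a non-zero coefficient in $v$. Construction. Choose $e_1,e\in\{\pm e_\lambda,\pm e_{1/\lambda}\}$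 and a positive cone $R$ of $\pi_1(M)$. Let $Q_1$ be the cone of $\mathbb Z^2$ given by $e_1$; let $Q_2$ be the set of non-zero $v\in G_2/[G_2,G_2]$ whose coefficient at $\max(v)$ is positive; let $Q_3=R\cap[G_2,G_2]$. Let $P$ be the set of all $g\in G$ such that $p_1(g)\in Q_1$, or $g\in G_2$ and $p_2(g)\in Q_2$, or $g\in Q_3$. Claim. For all these choices, $P$ is a positive cone of $G$, it is the restriction to $G$ of a positive cone of $\pi_1(M)$, and the bi-order it defines on $G$ is not standard. With respect to $P$, the group $G_2$ has no maximal convex subgroup. In fact, for $\gamma\in\mathcal B$ put $$C_\gamma=\{g\in G_2 : p_2(g)=0 \text{ or } \max(p_2(g))\le_e\gamma\}.$$ Then every $C_\gamma$ is a convex subgroup of $G_2$, $\gamma<_e\delta$ implies $C_\gamma\subsetneq C_\delta\subsetneq G_2$, and $\bigcup_{\gamma\in\mathcal B}C_\gamma=G_2$. -/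

import Mathlib

namespace PuncturedTorusBundle

/-! ### Bi-orders, given by their positive cones -/

/-- A (conjugation invariant) positive cone of a group `H`: closed under products, invariant under
conjugation, and `H` is the disjoint union of `P`, `P⁻¹` and `{1}`. -/
structure IsPositiveCone {H : Type*} [Group H] (P : Set H) : Prop where
  mul_mem : ∀ a ∈ P, ∀ b ∈ P, a * b ∈ P
  one_notMem : (1 : H) ∉ P
  inv_notMem : ∀ a ∈ P, a⁻¹ ∉ P
  exhaust : ∀ a : H, a ∈ P ∨ a⁻¹ ∈ P ∨ a = 1
  conj_mem_iff : ∀ g a : H, g⁻¹ * a * g ∈ P ↔ a ∈ P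

/-- The order attached to a positive cone: `a < b` if and only if `a⁻¹ b ∈ P`. -/
def coneLT {H : Type*} [Group H] (P : Set H) (a b : H) : Prop := a⁻¹ * b ∈ P

/-- A subgroup `C` is convex if `a < g < b` with `a, b ∈ C` forces `g ∈ C`. -/
def IsConvexSubgroup {H : Type*} [Group H] (P : Set H) (C : Subgroup H) : Prop :=
  ∀ a ∈ C, ∀ b ∈ C, ∀ g : H, coneLT P a g → coneLT P g b → g ∈ C

/-- A maximal convex subgroup: proper, convex, and the only convex subgroups containing it are
itself and the whole group. -/
def IsMaximalConvexSubgroup {H : Type*} [Group H] (P : Set H) (C : Subgroup H) : Prop :=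
  IsConvexSubgroup P C ∧ C ≠ ⊤ ∧
    ∀ D : Subgroup H, IsConvexSubgroup P D → C ≤ D → D = C ∨ D = ⊤

/-- A bi-order is standard if every term of the lower central series is convex. -/
def IsStandard {H : Type*} [Group H] (P : Set H) : Prop :=
  ∀ n : ℕ, IsConvexSubgroup P (((⊤ : Subgroup H).lowerCentralSeries n))

/-! ### The fundamental groups -/

/-- `G = π₁(T, x)`, the fundamental group of the once-punctured torus `T` with base point on `∂T`:
the free group on `α` and `β`. -/
abbrev G : Type := FreeGroup (Fin 2)

/-- The generator `α`. -/
def α : G := FreeGroup.of 0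

/-- The generator `β`. -/
def β : G := FreeGroup.of 1

/-- The class `γ₀ = α β α⁻¹ β⁻¹` of the boundary loop of `T`. -/
def boundaryLoop : G := α * β * α⁻¹ * β⁻¹

/-- The abelianization map `p₁ : G → H₁(T; ℤ) = ℤ²`, sending `α` to `(1, 0)` and `β` to `(0, 1)`. -/
def p₁ : G →* Multiplicative (Fin 2 → ℤ) :=
  FreeGroup.lift fun i => Multiplicative.ofAdd (Pi.single i (1 : ℤ))

/-- `p₁` with values in the additive group `ℤ²`. -/
def homologyClass (g : G) : Fin 2 → ℤ := Multiplicative.toAdd (p₁ g)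

/-- The matrix of the map `h₊` induced on `H₁(T; ℤ) = ℤ²` by an automorphism `h` of `G`: its columns
are the classes of `h α` and `h β`. -/
def hPlus (h : MulAut G) : Matrix (Fin 2) (Fin 2) ℤ :=
  Matrix.of fun i j => homologyClass (h (FreeGroup.of j)) i

/-- `h` is the automorphism of `π₁(T, x)` induced by the monodromy of an untwisted hyperbolic
once-punctured torus bundle. The monodromy fixes `∂T` pointwise, so `h` fixes the boundary loop
(and, conversely, all such automorphisms come from homeomorphisms fixing `∂T` pointwise); the bundle
is hyperbolic exactly when `|tr h₊| > 2`, and the eigenvalues of `h₊` are then positive (the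
untwisted case) exactly when `tr h₊ > 2`. -/
structure IsUntwistedHyperbolic (h : MulAut G) : Prop where
  fixes_boundary : h boundaryLoop = boundaryLoop
  two_lt_trace : 2 < (hPlus h).trace

/-- `π₁(M) = G ⋊ ℤ`, where the generator of `ℤ` acts on `G` by `h`. -/
abbrev bundleGroup (h : MulAut G) : Type :=
  SemidirectProduct G (Multiplicative ℤ) (zpowersHom (MulAut G) h)

/-! ### Orders on `ℤ²` -/

/-- `E` is an eigenbasis `(e_λ, e_{1/λ})` of `h₊` acting on `ℝ²`. -/
def IsEigenbasis (h : MulAut G) (lam : ℝ) (E : Module.Basis (Fin 2) ℝ (Fin 2 → ℝ)) : Prop :=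
  ((hPlus h).map (Int.cast : ℤ → ℝ)).mulVec (E 0) = lam • E 0 ∧
    ((hPlus h).map (Int.cast : ℤ → ℝ)).mulVec (E 1) = lam⁻¹ • E 1

/-- The four positive cones of `ℤ²` attached to the vectors `± e_λ`, `± e_{1/λ}`: the vectors `u`
having positive dot product with `s • E i`, where the dot product is the one in the coordinates with
respect to the eigenbasis `E`. -/
def eigenCone (E : Module.Basis (Fin 2) ℝ (Fin 2 → ℝ)) (i : Fin 2) (s : ℤˣ) : Set (Fin 2 → ℤ) :=
  {u | 0 < (((s : ℤ) : ℝ)) * E.repr (fun j => (u j : ℝ)) i}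

/-- The order on `ℤ²` attached to a cone. -/
def prec (Q : Set (Fin 2 → ℤ)) (u v : Fin 2 → ℤ) : Prop := v - u ∈ Q

/-! ### The homology of the abelian cover -/

/-- `G₂ = [G, G]`, the fundamental group of the abelian cover `T̂` of `T`. -/
abbrev G₂ : Subgroup G := commutator G

/-- `H₁(T̂; ℤ) = G₂ / [G₂, G₂]`, written additively. -/
abbrev coverHomology : Type := Additive (Abelianization G₂)

/-- The quotient map `p₂ : G₂ → G₂ / [G₂, G₂] = H₁(T̂; ℤ)`. -/
def p₂ (g : G₂) : coverHomology := Additive.ofMul (Abelianization.of g)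

theorem conj_boundaryLoop_mem (x : G) : x * boundaryLoop * x⁻¹ ∈ G₂ :=
  (inferInstance : (commutator G).Normal).conj_mem _
    (Subgroup.commutator_mem_commutator (Subgroup.mem_top α) (Subgroup.mem_top β)) x

/-- The homology class of the boundary component `γ` of `T̂` with `q(γ) = u = (m, n)`: the component
reached by the lift of `α^m β^n`. These classes are the elements of the basis `𝓑` of `H₁(T̂; ℤ)`,
indexed by `ℤ²` through the bijection `q`. -/
def boundaryClass (u : Fin 2 → ℤ) : coverHomology :=
  p₂ ⟨(α ^ u 0 * β ^ u 1) * boundaryLoop * (α ^ u 0 * β ^ u 1)⁻¹, conj_boundaryLoop_mem _⟩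

/-- `v = ∑ k_γ γ` is non-zero, its largest basis element `max(v)` with a non-zero coefficient is the
one with index `w`, and that coefficient is `k`. -/
def HasLeadingTerm (Q : Set (Fin 2 → ℤ)) (v : coverHomology) (w : Fin 2 → ℤ) (k : ℤ) : Prop :=
  ∃ c : (Fin 2 → ℤ) →₀ ℤ, v = c.sum (fun u a => a • boundaryClass u) ∧
    c w = k ∧ k ≠ 0 ∧ ∀ u, c u ≠ 0 → u ≠ w → prec Q u w

/-- The positive cone `Q₂` of `H₁(T̂; ℤ)`: the leading coefficient is positive. -/
def leadCone (Q : Set (Fin 2 → ℤ)) : Set coverHomology :=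
  {v | ∃ w k, HasLeadingTerm Q v w k ∧ 0 < k}

/-! ### The cone on `G` and the subgroups `C_γ` -/

/-- `Q₃`: the restriction to `[G₂, G₂]` of a positive cone `R` of `π₁(M)`. -/
def restCone (h : MulAut G) (R : Set (bundleGroup h)) : Set G :=
  {g | g ∈ ⁅G₂, G₂⁆ ∧ (SemidirectProduct.inl g : bundleGroup h) ∈ R}

/-- The constructed positive cone `P` of `G`, made of `Q₁`, of `Q₂` (built from the order on `ℤ²` with
cone `Q`) and of `Q₃`. -/
def constructedCone (h : MulAut G) (Q₁ Q : Set (Fin 2 → ℤ)) (R : Set (bundleGroup h)) : Set G :=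
  {g | homologyClass g ∈ Q₁ ∨ (∃ hg : g ∈ G₂, p₂ ⟨g, hg⟩ ∈ leadCone Q) ∨ g ∈ restCone h R}

/-- The restriction of a cone to `G₂`. -/
def restrictG₂ (P : Set G) : Set G₂ := {g | (g : G) ∈ P}

/-- The set `C_γ`, for `γ` with index `u`: the elements `g` of `G₂` with `p₂(g) = 0` or
`max(p₂(g)) ≤ γ`. -/
def convexPiece (Q : Set (Fin 2 → ℤ)) (u : Fin 2 → ℤ) : Set G₂ :=
  {g | p₂ g = 0 ∨ ∃ w k, HasLeadingTerm Q (p₂ g) w k ∧ (w = u ∨ prec Q w u)}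

end PuncturedTorusBundle

open PuncturedTorusBundle

/-!
A bi-order with a convex normal series is assembled from conjugation invariant orders on its
layers. Here the layers are `G / G₂ = ℤ²`, `G₂ / [G₂, G₂] = H₁(T̂; ℤ)` and `[G₂, G₂]`. Winding
numbers around the boundary components of `T̂` show that their classes form a basis `𝓑` of
`H₁(T̂; ℤ)`. An element `x` of `G` permutes `𝓑` as translation by its class in `ℤ²`, and `h`
permutes `𝓑` as an affine map with linear part `h₊`, which scales the linear forms defining the
eigencones by positive factors. All these permutations preserve the order on `𝓑`, hence also the
sign of the leading coefficient, so the constructed cone is invariant under conjugation and under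
`h`.

The sum of all coefficients with respect to `𝓑` is a homomorphism on `G₂` invariant under
conjugation; it vanishes on `[G, G₂]` but not on `γ₀`. On the other hand `1 < γ₀ < x γ₀ x⁻¹ γ₀⁻¹`
whenever the class of `x` is positive, so `[G, G₂]` is not convex.
-/

namespace PuncturedTorusBundle

/-! ### Positive cones and convex subgroups -/

section Cone

variable {H K A : Type*} [Group H] [Group K] [Group A] {P : Set H} {N N₁ N₂ : Subgroup H}

theorem isPositiveCone_preimage_pos {A B : Type*} [AddCommGroup A] [AddCommGroup B] [LinearOrder B]
    [IsOrderedAddMonoid B] {f : A →+ B} (hf : Function.Injective f) :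
    IsPositiveCone (Multiplicative.toAdd ⁻¹' {u | 0 < f u}) where
  mul_mem a ha b hb := by simpa using add_pos ha hb
  one_notMem := by simp
  inv_notMem a ha := by simpa using le_of_lt ha
  exhaust a := by
    rcases lt_trichotomy (f a.toAdd) 0 with ha | ha | ha
    · exact Or.inr (Or.inl (by simpa using ha))
    · exact Or.inr (Or.inr ((injective_iff_map_eq_zero f).mp hf _ ha))
    · exact Or.inl ha
  conj_mem_iff g a := by rw [mul_comm, mul_inv_cancel_left]

theorem IsPositiveCone.preimage {f : K →* H} (hP : IsPositiveCone P)
    (hf : Function.Injective f) : IsPositiveCone (f ⁻¹' P) where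
  mul_mem a ha b hb := by simpa using hP.mul_mem _ ha _ hb
  one_notMem := by simpa using hP.one_notMem
  inv_notMem a ha := by simpa using hP.inv_notMem _ ha
  exhaust a := by simpa [map_eq_one_iff f hf] using hP.exhaust (f a)
  conj_mem_iff g a := by simpa using hP.conj_mem_iff (f g) (f a)

theorem IsPositiveCone.conj_mem (hP : IsPositiveCone P) {a : H} (ha : a ∈ P) (g : H) :
    g * a * g⁻¹ ∈ P := by
  simpa using (hP.conj_mem_iff g⁻¹ a).mpr ha

theorem IsPositiveCone.mul_mem_comm (hP : IsPositiveCone P) {a b : H} (h : a * b ∈ P) :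
    b * a ∈ P := by
  simpa [mul_assoc] using hP.conj_mem h b

/-- The set `S ⊆ N` is the preimage of a positive cone of the quotient `N / N'` that is invariant
under conjugation by the ambient group. A bi-order with convex normal subgroups `N' ≤ N` has such a
layer, and conversely positive cones are assembled from their layers. It is formulated without the
quotient, so that all layers are sets of elements of the same group. -/
structure IsConeModulo (N N' : Subgroup H) (S : Set H) : Prop where
  le : N' ≤ N
  subset : S ⊆ N
  mul_mem : ∀ a ∈ S, ∀ b ∈ S, a * b ∈ S
  mul_mem_right : ∀ a ∈ S, ∀ n ∈ N', a * n ∈ S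
  notMem : ∀ a ∈ S, a ∉ N'
  exhaust : ∀ a ∈ N, a ∈ S ∨ a⁻¹ ∈ S ∨ a ∈ N'
  conj_mem : ∀ a ∈ S, ∀ g : H, g * a * g⁻¹ ∈ S

theorem IsPositiveCone.isConeModulo_ker {Q : Set A} (hQ : IsPositiveCone Q) (f : H →* A) :
    IsConeModulo ⊤ f.ker (f ⁻¹' Q) where
  le := le_top
  subset := Set.subset_univ _
  mul_mem a ha b hb := by simpa using hQ.mul_mem _ ha _ hb
  mul_mem_right a ha n hn := by simpa [MonoidHom.mem_ker.mp hn] using ha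
  notMem a ha ha' := hQ.one_notMem (by simpa [MonoidHom.mem_ker.mp ha'] using ha)
  exhaust a _ := by simpa [MonoidHom.mem_ker] using hQ.exhaust (f a)
  conj_mem a ha g := by simpa using hQ.conj_mem ha (f g)

theorem IsPositiveCone.isConeModulo_inter (hP : IsPositiveCone P) (N : Subgroup H) [N.Normal] :
    IsConeModulo N ⊥ (N ∩ P) where
  le := bot_le
  subset := Set.inter_subset_left
  mul_mem a ha b hb := ⟨N.mul_mem ha.1 hb.1, hP.mul_mem a ha.2 b hb.2⟩
  mul_mem_right a ha n hn := by simpa [Subgroup.mem_bot.mp hn] using ha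
  notMem a ha ha' := hP.one_notMem (Subgroup.mem_bot.mp ha' ▸ ha.2)
  exhaust a ha := by simpa [ha] using hP.exhaust a
  conj_mem a ha g := ⟨Subgroup.Normal.conj_mem inferInstance a ha.1 g, hP.conj_mem ha.2 g⟩

theorem IsConeModulo.union {S T : Set H} (hS : IsConeModulo N N₁ S) (hT : IsConeModulo N₁ N₂ T) :
    IsConeModulo N N₂ (S ∪ T) where
  le := hT.le.trans hS.le
  subset := Set.union_subset hS.subset (hT.subset.trans hS.le)
  mul_mem := by
    rintro a (ha | ha) b (hb | hb)
    · exact Or.inl (hS.mul_mem a ha b hb)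
    · exact Or.inl (hS.mul_mem_right a ha b (hT.subset hb))
    · have hconj := hS.mul_mem_right _ (hS.conj_mem b hb a) a (hT.subset ha)
      exact Or.inl (by simpa using hconj)
    · exact Or.inr (hT.mul_mem a ha b hb)
  mul_mem_right a ha n hn :=
    ha.imp (hS.mul_mem_right a · n (hT.le hn)) (hT.mul_mem_right a · n hn)
  notMem a ha hn := ha.elim (hS.notMem a · (hT.le hn)) (hT.notMem a · hn)
  exhaust a ha := by
    rcases hS.exhaust a ha with h | h | h
    · exact Or.inl (Or.inl h)
    · exact Or.inr (Or.inl (Or.inl h))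
    · exact (hT.exhaust a h).imp Or.inr (Or.imp_left Or.inr)
  conj_mem a ha g := ha.imp (hS.conj_mem a · g) (hT.conj_mem a · g)

theorem IsConeModulo.isPositiveCone (hP : IsConeModulo ⊤ ⊥ P) : IsPositiveCone P where
  mul_mem := hP.mul_mem
  one_notMem h := hP.notMem 1 h (one_mem _)
  inv_notMem a ha ha' := hP.notMem _ (hP.mul_mem a ha _ ha') (by simp)
  exhaust a := hP.exhaust a (Subgroup.mem_top a)
  conj_mem_iff g a :=
    ⟨fun h => by simpa [mul_assoc] using hP.conj_mem _ h g,
      fun h => by simpa using hP.conj_mem _ h g⁻¹⟩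

theorem isPositiveCone_semidirectProduct {φ : K →* MulAut H} {C : Set K} (hC : IsPositiveCone C)
    (hP : IsPositiveCone P) (hφ : ∀ k, ∀ a ∈ P, φ k a ∈ P) :
    IsPositiveCone
      (SemidirectProduct.rightHom ⁻¹' C ∪ SemidirectProduct.inl '' P : Set (H ⋊[φ] K)) := by
  refine ((hC.isConeModulo_ker _).union (T := SemidirectProduct.inl '' P) ?_).isPositiveCone
  rw [← SemidirectProduct.range_inl_eq_ker_rightHom]
  refine
    { le := bot_le
      subset := Set.image_subset_range _ _
      mul_mem := ?_
      mul_mem_right := ?_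
      notMem := ?_
      exhaust := ?_
      conj_mem := ?_ }
  · rintro _ ⟨a, ha, rfl⟩ _ ⟨b, hb, rfl⟩
    exact ⟨a * b, hP.mul_mem a ha b hb, map_mul _ _ _⟩
  · rintro a ha n hn
    simpa [Subgroup.mem_bot.mp hn] using ha
  · rintro _ ⟨a, ha, rfl⟩ h
    exact hP.one_notMem (SemidirectProduct.inl_injective h ▸ ha)
  · rintro _ ⟨a, rfl⟩
    simp only [← map_inv, SemidirectProduct.inl_injective.mem_set_image, Subgroup.mem_bot,
      map_eq_one_iff _ SemidirectProduct.inl_injective]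
    exact hP.exhaust a
  · rintro _ ⟨a, ha, rfl⟩ g
    refine ⟨g.left * φ g.right a * g.left⁻¹, hP.conj_mem (hφ _ a ha) _, ?_⟩
    ext <;> simp

theorem IsPositiveCone.map_mem_iff (hP : IsPositiveCone P) {φ : MulAut H}
    (hφ : ∀ a ∈ P, φ a ∈ P) {a : H} : φ a ∈ P ↔ a ∈ P := by
  refine ⟨fun h => ?_, hφ a⟩
  rcases hP.exhaust a with ha | ha | rfl
  · exact ha
  · exact absurd (by simpa using hφ _ ha) (hP.inv_notMem _ h)
  · exact absurd (by simpa using h) hP.one_notMem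

theorem IsPositiveCone.zpow_map_mem (hP : IsPositiveCone P) {φ : MulAut H}
    (hφ : ∀ a ∈ P, φ a ∈ P) (n : ℤ) {a : H} (ha : a ∈ P) : (φ ^ n) a ∈ P := by
  induction n generalizing a with
  | zero => simpa using ha
  | succ n ih =>
    rw [zpow_add_one]
    exact ih (hφ a ha)
  | pred n ih =>
    rw [zpow_sub_one]
    exact ih ((hP.map_mem_iff hφ).mp (by simpa using ha))

theorem exists_isPositiveCone_semidirectProduct_zpowersHom (hP : IsPositiveCone P) {φ : MulAut H}
    (hφ : ∀ a ∈ P, φ a ∈ P) :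
    ∃ P' : Set (H ⋊[zpowersHom (MulAut H) φ] Multiplicative ℤ), IsPositiveCone P' ∧
      ∀ a, SemidirectProduct.inl a ∈ P' ↔ a ∈ P := by
  have hC := isPositiveCone_preimage_pos (f := AddMonoidHom.id ℤ) Function.injective_id
  refine ⟨_, isPositiveCone_semidirectProduct hC hP fun k a ha => ?_, fun a => ?_⟩
  · rw [zpowersHom_apply]
    exact hP.zpow_map_mem hφ _ ha
  · simp [SemidirectProduct.inl_injective.mem_set_image]

theorem isConvexSubgroup_iff (hP : IsPositiveCone P) {C : Subgroup H} :
    IsConvexSubgroup P C ↔ ∀ c ∈ C, ∀ a ∈ P, a ∉ C → c * a ∈ P := by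
  constructor
  · intro hC c hc a ha haC
    rcases hP.exhaust (c * a) with h | h | h
    · exact h
    · refine absurd (hC 1 (one_mem C) c⁻¹ (inv_mem hc) a (by simpa [coneLT] using ha) ?_) haC
      simpa [coneLT] using h
    · exact absurd (eq_inv_of_mul_eq_one_right h ▸ inv_mem hc) haC
  · intro hC a ha b hb g hag hgb
    by_contra hg
    have hg_pos : a * (a⁻¹ * g) ∈ P :=
      hC a ha _ hag fun h => hg ((mul_mem_cancel_left (inv_mem ha)).mp h)
    have hg_neg : b⁻¹ * (b * g⁻¹) ∈ P :=
      hC _ (inv_mem hb) _ (hP.mul_mem_comm hgb) fun h =>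
        hg (inv_mem_iff.mp ((mul_mem_cancel_left hb).mp h))
    rw [mul_inv_cancel_left] at hg_pos
    rw [inv_mul_cancel_left] at hg_neg
    exact hP.inv_notMem g hg_pos hg_neg

theorem IsConvexSubgroup.le_total {C D : Subgroup H} (hC : IsConvexSubgroup P C)
    (hD : IsConvexSubgroup P D) (hP : IsPositiveCone P) : C ≤ D ∨ D ≤ C := by
  refine or_iff_not_imp_right.mpr fun hDC => ?_
  obtain ⟨d, hd, hdC⟩ := SetLike.not_le_iff_exists.mp hDC
  wlog hdP : d ∈ P generalizing d
  · rcases hP.exhaust d with h | h | rfl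
    · exact absurd h hdP
    · exact this d⁻¹ (inv_mem hd) (by simpa using hdC) h
    · exact absurd (one_mem C) hdC
  intro c hc
  have hneg : c⁻¹ * d ∈ P := (isConvexSubgroup_iff hP).mp hC _ (inv_mem hc) d hdP hdC
  have hpos : d * c ∈ P := hP.mul_mem_comm ((isConvexSubgroup_iff hP).mp hC c hc d hdP hdC)
  exact hD d⁻¹ (inv_mem hd) d hd c (by simpa [coneLT] using hpos) hneg

theorem not_isMaximalConvexSubgroup_of_exhaustion {ι : Type*} {C : ι → Subgroup H}
    (hP : IsPositiveCone P) (hC : ∀ i, IsConvexSubgroup P (C i)) (hlt : ∀ i, ∃ j, C i < C j)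
    (hcover : ∀ g, ∃ i, g ∈ C i) (D : Subgroup H) : ¬ IsMaximalConvexSubgroup P D := by
  rintro ⟨hD, hDtop, hmax⟩
  obtain ⟨g, -, hg⟩ := SetLike.exists_of_lt (lt_top_iff_ne_top.mpr hDtop)
  obtain ⟨i, hi⟩ := hcover g
  have hDi : D ≤ C i := (hD.le_total (hC i) hP).resolve_right fun h => hg (h hi)
  obtain ⟨j, hij⟩ := hlt i
  obtain ⟨k, hjk⟩ := hlt j
  rcases hmax (C j) (hC j) (hDi.trans hij.le) with h | h
  · exact (hDi.trans_lt hij).ne' h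
  · exact (hjk.trans_le le_top).ne h

end Cone

/-! ### Leading coefficients -/

section LeadingCoefficient

variable {ι κ M : Type*} {r : ι → ι → Prop} {s : κ → κ → Prop}

/-- The index `w` is the largest one, for the strict total order `r`, where `f` does not vanish. -/
def IsLeadingIndex [Zero M] (r : ι → ι → Prop) (f : ι →₀ M) (w : ι) : Prop :=
  f w ≠ 0 ∧ ∀ u, r w u → f u = 0

/-- The coefficient of `f` at its leading index for `r` is positive. If `r` is a strict total order,
such functions are the positive elements of the antilexicographic order on `ι →₀ M`. -/
def LeadPos [Zero M] [LT M] (r : ι → ι → Prop) (f : ι →₀ M) : Prop :=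
  ∃ w, 0 < f w ∧ ∀ u, r w u → f u = 0

theorem IsLeadingIndex.forall_eq_zero_iff [Zero M] [IsStrictTotalOrder ι r] {f : ι →₀ M} {w : ι}
    (hw : IsLeadingIndex r f w) {u : ι} : (∀ v, r u v → f v = 0) ↔ ¬ r u w := by
  refine ⟨fun h huw => hw.1 (h w huw), fun huw v huv => hw.2 v ?_⟩
  rcases trichotomous_of r w v with h | rfl | h
  · exact h
  · exact absurd huv huw
  · exact absurd (_root_.trans huv h) huw

theorem IsLeadingIndex.eq_or_rel [Zero M] [Std.Trichotomous r] {f : ι →₀ M} {w u : ι}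
    (hw : IsLeadingIndex r f w) (hu : f u ≠ 0) : w = u ∨ r u w := by
  rcases trichotomous_of r w u with h | h | h
  · exact absurd (hw.2 u h) hu
  · exact Or.inl h
  · exact Or.inr h

theorem exists_isLeadingIndex [Zero M] [IsStrictOrder ι r] {f : ι →₀ M} (hf : f ≠ 0) :
    ∃ w, IsLeadingIndex r f w := by
  classical
  let := partialOrderOfSO r
  obtain ⟨w, hw⟩ := f.support.exists_maximal (Finsupp.support_nonempty_iff.mpr hf)
  refine ⟨w, Finsupp.mem_support_iff.mp hw.prop, fun u hu => ?_⟩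
  exact Finsupp.notMem_support_iff.mp fun hmem => hw.not_gt hmem hu

theorem not_leadPos_zero [Zero M] [Preorder M] : ¬ LeadPos r (0 : ι →₀ M) :=
  fun ⟨_, hw, _⟩ => lt_irrefl _ hw

theorem leadPos_or_neg [AddCommGroup M] [LinearOrder M] [IsOrderedAddMonoid M]
    [IsStrictOrder ι r] (f : ι →₀ M) : LeadPos r f ∨ LeadPos r (-f) ∨ f = 0 := by
  rcases eq_or_ne f 0 with hf | hf
  · exact Or.inr (Or.inr hf)
  · obtain ⟨w, hw, hzero⟩ := exists_isLeadingIndex (r := r) hf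
    rcases lt_or_gt_of_ne hw with hneg | hpos
    · exact Or.inr (Or.inl ⟨w, by simpa using hneg, fun u hu => by simp [hzero u hu]⟩)
    · exact Or.inl ⟨w, hpos, hzero⟩

theorem LeadPos.add_of_vanishing_above [AddZeroClass M] [Preorder M] [IsStrictTotalOrder ι r]
    {f g : ι →₀ M} (hf : LeadPos r f) {u : ι} (hg : ∀ v, r u v → g v = 0)
    (hfu : ¬ ∀ v, r u v → f v = 0) : LeadPos r (g + f) := by
  obtain ⟨w, hpos, hzero⟩ := hf
  have huw : r u w := by
    rwa [IsLeadingIndex.forall_eq_zero_iff ⟨hpos.ne', hzero⟩, not_not] at hfu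
  exact ⟨w, by simpa [hg w huw] using hpos,
    fun v hv => by simp [hzero v hv, hg v (_root_.trans huw hv)]⟩

theorem LeadPos.add [AddZeroClass M] [Preorder M] [AddLeftStrictMono M]
    [IsStrictTotalOrder ι r] {f g : ι →₀ M} (hf : LeadPos r f) (hg : LeadPos r g) :
    LeadPos r (f + g) := by
  obtain ⟨w, hpos, hzero⟩ := hf
  obtain ⟨w', hpos', hzero'⟩ := hg
  rcases trichotomous_of r w w' with h | rfl | h
  · exact ⟨w', by simpa [hzero w' h] using hpos',
      fun u hu => by simp [hzero u (_root_.trans h hu), hzero' u hu]⟩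
  · exact ⟨w, add_pos hpos hpos', fun u hu => by simp [hzero u hu, hzero' u hu]⟩
  · exact ⟨w, by simpa [hzero' w h] using hpos,
      fun u hu => by simp [hzero u hu, hzero' u (_root_.trans h hu)]⟩

theorem LeadPos.mapDomain [AddCommMonoid M] [LT M] [Std.Trichotomous r] [Std.Asymm s]
    {σ : ι → κ} (hσ : ∀ u v, r u v → s (σ u) (σ v)) {f : ι →₀ M} (hf : LeadPos r f) :
    LeadPos s (f.mapDomain σ) := by
  have hinj : Function.Injective σ := fun u v huv => by
    rcases trichotomous_of r u v with h | h | h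
    · exact absurd (huv ▸ hσ u v h) (irrefl _)
    · exact h
    · exact absurd (huv ▸ hσ v u h) (irrefl _)
  obtain ⟨w, hpos, hzero⟩ := hf
  refine ⟨σ w, by rwa [Finsupp.mapDomain_apply hinj], fun x hx => ?_⟩
  by_cases hrange : x ∈ Set.range σ
  · obtain ⟨u, rfl⟩ := hrange
    rw [Finsupp.mapDomain_apply hinj]
    rcases trichotomous_of r w u with h | rfl | h
    · exact hzero u h
    · exact absurd hx (irrefl _)
    · exact absurd hx (asymm (hσ u w h))
  · exact Finsupp.mapDomain_of_notMem_range f x hrange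

end LeadingCoefficient

/-! ### The orders on `ℤ²` -/

section OrderOnPlane

variable {Q : Set (Fin 2 → ℤ)}

theorem isStrictTotalOrder_prec (hQ : IsPositiveCone (Multiplicative.toAdd ⁻¹' Q)) :
    IsStrictTotalOrder (Fin 2 → ℤ) (prec Q) where
  irrefl u hu := hQ.one_notMem (by simpa [prec] using hu)
  trans u v w huv hvw := by
    have huw : (w - v) + (v - u) ∈ Q := hQ.mul_mem _ hvw _ huv
    rwa [sub_add_sub_cancel] at huw
  trichotomous u v huv hvu := by
    rcases hQ.exhaust (Multiplicative.ofAdd (v - u)) with h | h | h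
    · exact absurd h huv
    · exact absurd (by simpa [prec] using h) hvu
    · exact (sub_eq_zero.mp h).symm

theorem prec_add_right_iff {u v : Fin 2 → ℤ} (w : Fin 2 → ℤ) :
    prec Q (u + w) (v + w) ↔ prec Q u v := by
  simp only [prec, add_sub_add_right_eq_sub]

theorem exists_prec (hQ : IsPositiveCone (Multiplicative.toAdd ⁻¹' Q)) (u : Fin 2 → ℤ) :
    ∃ v, prec Q u v := by
  obtain ⟨w, hw⟩ := exists_ne (0 : Fin 2 → ℤ)
  rcases hQ.exhaust (Multiplicative.ofAdd w) with h | h | h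
  · exact ⟨u + w, by simpa [prec] using h⟩
  · exact ⟨u - w, by simpa [prec] using h⟩
  · exact absurd h hw

end OrderOnPlane

/-! ### The eigencones -/

theorem irrational_of_add_inv_eq_intCast {t : ℤ} (ht : 2 < t) {μ : ℝ} (hμ : μ + μ⁻¹ = t) :
    Irrational μ := by
  rintro ⟨q, rfl⟩
  have hq : q + q⁻¹ = t := by exact_mod_cast hμ
  have hq₀ : q ≠ 0 := by
    rintro rfl
    have ht₀ : t = 0 := by simpa using hq.symm
    lia
  -- The discriminant of `x² - t x + 1` is `(q - q⁻¹)²`, but `(t - 1)² < t² - 4 < t²`.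
  have hsq : IsSquare ((t ^ 2 - 4 : ℤ) : ℚ) := by
    refine ⟨q - q⁻¹, ?_⟩
    push_cast
    rw [← hq]
    field_simp
    ring
  obtain ⟨s, hs⟩ := Rat.isSquare_intCast_iff.mp hsq
  have hlt : |s| < t := abs_lt_of_sq_lt_sq (by nlinarith) (by lia)
  have habs : |s| * |s| = t ^ 2 - 4 := by rw [abs_mul_abs_self, hs]
  nlinarith [abs_nonneg s]

theorem not_irrational_of_mulVec_eq_smul {n : Type*} [Fintype n] (A : Matrix n n ℤ) {μ : ℝ}
    {u : n → ℤ} (hu : u ≠ 0)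
    (h : (A.map (Int.cast : ℤ → ℝ)).mulVec (fun j => (u j : ℝ)) = μ • fun j => (u j : ℝ)) :
    ¬ Irrational μ := by
  obtain ⟨j, hj⟩ := Function.ne_iff.mp hu
  have hj' : (u j : ℝ) ≠ 0 := by exact_mod_cast hj
  have hμ : ((A.mulVec u j : ℤ) : ℝ) = μ * u j :=
    (RingHom.map_mulVec (Int.castRingHom ℝ) A u j).trans (congrFun h j)
  exact fun hirr => hirr ⟨A.mulVec u j / u j, by push_cast; rw [hμ, mul_div_cancel_right₀ _ hj']⟩

section EigenCone

variable {h : MulAut G} {lam : ℝ} {E : Module.Basis (Fin 2) ℝ (Fin 2 → ℝ)}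

theorem IsEigenbasis.trace_eq (hE : IsEigenbasis h lam E) :
    ((hPlus h).trace : ℝ) = lam + lam⁻¹ := by
  set A := (hPlus h).map (Int.cast : ℤ → ℝ) with hA
  have hcast : ((hPlus h).trace : ℝ) = A.trace := by simp [hA, Matrix.trace]
  rw [hcast, ← Matrix.trace_toLin'_eq, LinearMap.trace_eq_matrix_trace ℝ E, Matrix.trace_fin_two,
    LinearMap.toMatrix_apply, LinearMap.toMatrix_apply, Matrix.toLin'_apply, Matrix.toLin'_apply,
    hE.1, hE.2]
  simp

theorem IsEigenbasis.repr_mulVec (hE : IsEigenbasis h lam E) (i : Fin 2) (v : Fin 2 → ℝ) :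
    E.repr (((hPlus h).map (Int.cast : ℤ → ℝ)).mulVec v) i = ![lam, lam⁻¹] i * E.repr v i := by
  conv_lhs => rw [← E.sum_repr v]
  rw [Fin.sum_univ_two, Matrix.mulVec_add, Matrix.mulVec_smul, Matrix.mulVec_smul, hE.1, hE.2]
  fin_cases i <;> simp [mul_comm]

theorem IsEigenbasis.mulVec_eq_smul_of_repr_eq_zero (hE : IsEigenbasis h lam E) {i : Fin 2}
    {v : Fin 2 → ℝ} (hv : E.repr v i = 0) :
    ((hPlus h).map (Int.cast : ℤ → ℝ)).mulVec v = ![lam⁻¹, lam] i • v := by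
  apply E.repr.injective
  ext k
  rw [hE.repr_mulVec, map_smul, Finsupp.smul_apply, smul_eq_mul]
  fin_cases i <;> fin_cases k <;> simp_all

theorem IsEigenbasis.irrational (hE : IsEigenbasis h lam E) (htr : 2 < (hPlus h).trace)
    (i : Fin 2) : Irrational (![lam⁻¹, lam] i) := by
  refine irrational_of_add_inv_eq_intCast htr ?_
  rw [hE.trace_eq]
  fin_cases i <;> simp [add_comm]

theorem IsEigenbasis.pos (hE : IsEigenbasis h lam E) (htr : 2 < (hPlus h).trace) :
    0 < lam := by
  have htrace : (2 : ℝ) < (hPlus h).trace := by exact_mod_cast htr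
  by_contra! hneg
  linarith [hE.trace_eq, inv_nonpos.mpr hneg]

/-- The linear form on `ℤ²` whose positive elements form `eigenCone E i s`. -/
noncomputable def eigenForm (E : Module.Basis (Fin 2) ℝ (Fin 2 → ℝ)) (i : Fin 2) (s : ℤˣ) :
    (Fin 2 → ℤ) →+ ℝ :=
  (((s : ℤ) : ℝ) • E.coord i).toAddMonoidHom.comp ((Int.castAddHom ℝ).compLeft (Fin 2))

theorem eigenForm_apply (i : Fin 2) (s : ℤˣ) (u : Fin 2 → ℤ) :
    eigenForm E i s u = ((s : ℤ) : ℝ) * E.repr (fun j => (u j : ℝ)) i := rfl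

theorem IsEigenbasis.eigenForm_injective (hE : IsEigenbasis h lam E)
    (htr : 2 < (hPlus h).trace) (i : Fin 2) (s : ℤˣ) :
    Function.Injective (eigenForm E i s) := by
  refine (injective_iff_map_eq_zero _).mpr fun u hu => ?_
  have hs : ((s : ℤ) : ℝ) ≠ 0 := by exact_mod_cast s.ne_zero
  have hrepr : E.repr (fun j => (u j : ℝ)) i = 0 := (mul_eq_zero.mp hu).resolve_left hs
  by_contra hne
  exact not_irrational_of_mulVec_eq_smul _ hne (hE.mulVec_eq_smul_of_repr_eq_zero hrepr)
    (hE.irrational htr i)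

theorem IsEigenbasis.eigenForm_mulVec (hE : IsEigenbasis h lam E) (i : Fin 2) (s : ℤˣ)
    (u : Fin 2 → ℤ) :
    eigenForm E i s ((hPlus h).mulVec u) = ![lam, lam⁻¹] i * eigenForm E i s u := by
  have hcast : (fun j => ((hPlus h).mulVec u j : ℝ)) =
      ((hPlus h).map (Int.cast : ℤ → ℝ)).mulVec fun j => (u j : ℝ) :=
    funext (RingHom.map_mulVec (Int.castRingHom ℝ) (hPlus h) u)
  rw [eigenForm_apply, eigenForm_apply, hcast, hE.repr_mulVec, mul_left_comm]

theorem IsEigenbasis.isPositiveCone_eigenCone (hE : IsEigenbasis h lam E)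
    (htr : 2 < (hPlus h).trace) (i : Fin 2) (s : ℤˣ) :
    IsPositiveCone (Multiplicative.toAdd ⁻¹' eigenCone E i s) :=
  isPositiveCone_preimage_pos (hE.eigenForm_injective htr i s)

theorem IsEigenbasis.mulVec_mem_eigenCone (hE : IsEigenbasis h lam E)
    (htr : 2 < (hPlus h).trace) (i : Fin 2) (s : ℤˣ) {u : Fin 2 → ℤ}
    (hu : u ∈ eigenCone E i s) : (hPlus h).mulVec u ∈ eigenCone E i s := by
  have hpos : 0 < ![lam, lam⁻¹] i := by fin_cases i <;> simp [hE.pos htr]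
  change 0 < eigenForm E i s ((hPlus h).mulVec u)
  rw [hE.eigenForm_mulVec]
  exact mul_pos hpos hu

end EigenCone

/-! ### Homology of the punctured torus -/

theorem homologyClass_one : homologyClass 1 = 0 := by simp [homologyClass]

theorem homologyClass_mul (x y : G) :
    homologyClass (x * y) = homologyClass x + homologyClass y := by simp [homologyClass]

theorem homologyClass_inv (x : G) : homologyClass x⁻¹ = -homologyClass x := by
  simp [homologyClass]

theorem homologyClass_of (i : Fin 2) : homologyClass (FreeGroup.of i) = Pi.single i 1 := by
  simp [homologyClass, p₁]

theorem homologyClass_α_zpow_mul_β_zpow (u : Fin 2 → ℤ) :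
    homologyClass (α ^ u 0 * β ^ u 1) = u := by
  have hα : p₁ α = Multiplicative.ofAdd (Pi.single 0 1) := by simp [p₁, α]
  have hβ : p₁ β = Multiplicative.ofAdd (Pi.single 1 1) := by simp [p₁, β]
  ext i
  fin_cases i <;> simp [homologyClass, hα, hβ]

theorem homologyClass_map (h : MulAut G) (x : G) :
    homologyClass (h x) = (hPlus h).mulVec (homologyClass x) := by
  have hof (i : Fin 2) : homologyClass (h (FreeGroup.of i)) =
      (hPlus h).mulVec (homologyClass (FreeGroup.of i)) := by
    rw [homologyClass_of, Matrix.mulVec_single_one]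
    rfl
  induction x using FreeGroup.induction_on with
  | C1 => simp [homologyClass_one]
  | of i => exact hof i
  | inv_of i hi => rw [map_inv, homologyClass_inv, homologyClass_inv, hi, Matrix.mulVec_neg]
  | mul x y hx hy =>
    rw [map_mul, homologyClass_mul, homologyClass_mul, hx, hy, Matrix.mulVec_add]

theorem map_eq_zpow_mul_zpow_of_commute {H : Type*} [Group H] {f : G →* H}
    (hf : Commute (f α) (f β)) (g : G) :
    f g = f α ^ homologyClass g 0 * f β ^ homologyClass g 1 := by
  induction g using FreeGroup.induction_on with
  | C1 => simp [homologyClass_one]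
  | of i => fin_cases i <;> simp [homologyClass_of, α, β]
  | inv_of i _ => fin_cases i <;> simp [homologyClass_of, homologyClass_inv, α, β]
  | mul x y hx hy =>
    simp only [map_mul, hx, hy, homologyClass_mul, Pi.add_apply, zpow_add]
    exact (hf.symm.zpow_zpow _ _).mul_mul_mul_comm _ _

theorem mem_normalClosure_boundaryLoop_of_homologyClass_eq_zero {g : G}
    (hg : homologyClass g = 0) : g ∈ Subgroup.normalClosure {boundaryLoop} := by
  have hcomm : Commute (QuotientGroup.mk' (Subgroup.normalClosure {boundaryLoop}) α)
      (QuotientGroup.mk' (Subgroup.normalClosure {boundaryLoop}) β) := by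
    rw [← commutatorElement_eq_one_iff_commute, ← map_commutatorElement]
    exact (QuotientGroup.eq_one_iff _).mpr (Subgroup.subset_normalClosure rfl)
  refine (QuotientGroup.eq_one_iff g).mp ?_
  simpa [hg] using map_eq_zpow_mul_zpow_of_commute hcomm g

theorem boundaryLoop_mem : boundaryLoop ∈ G₂ := by simpa using conj_boundaryLoop_mem 1

theorem normalClosure_boundaryLoop : Subgroup.normalClosure {boundaryLoop} = G₂ := by
  refine le_antisymm (Subgroup.normalClosure_le_normal ?_) fun g hg => ?_
  · simpa using boundaryLoop_mem
  · exact mem_normalClosure_boundaryLoop_of_homologyClass_eq_zero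
      (Abelianization.commutator_subset_ker p₁ hg)

theorem ker_p₁ : p₁.ker = G₂ :=
  le_antisymm
    (fun _ hg => normalClosure_boundaryLoop ▸
      mem_normalClosure_boundaryLoop_of_homologyClass_eq_zero hg)
    (Abelianization.commutator_subset_ker p₁)

theorem mem_commutator_iff {g : G} : g ∈ G₂ ↔ homologyClass g = 0 := by
  rw [← ker_p₁]
  rfl

/-! ### Homology of the abelian cover -/

/-- The conjugate of the boundary loop by `x`, which encircles the boundary component of `T̂` where
the lift of `x` ends. -/
def conjBoundaryLoop (x : G) : G₂ := ⟨x * boundaryLoop * x⁻¹, conj_boundaryLoop_mem x⟩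

theorem closure_range_conjBoundaryLoop : Subgroup.closure (Set.range conjBoundaryLoop) = ⊤ := by
  have himage : G₂.subtype '' Set.range conjBoundaryLoop =
      Group.conjugatesOfSet {boundaryLoop} := by
    ext g
    simp [Group.mem_conjugatesOfSet_iff, isConj_iff, conjBoundaryLoop]
  apply Subgroup.map_injective G₂.subtype_injective
  rw [MonoidHom.map_closure, himage, ← MonoidHom.range_eq_map, Subgroup.range_subtype]
  exact normalClosure_boundaryLoop

theorem p₂_mul (a b : G₂) : p₂ (a * b) = p₂ a + p₂ b := rfl

theorem p₂_inv (a : G₂) : p₂ a⁻¹ = -p₂ a := rfl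

theorem p₂_eq_zero_iff {g : G₂} : p₂ g = 0 ↔ (g : G) ∈ ⁅G₂, G₂⁆ := by
  rw [← Subgroup.map_subtype_commutator]
  exact (QuotientGroup.eq_one_iff g).trans
    (Subgroup.mem_map_iff_mem G₂.subtype_injective).symm

theorem p₂_conjBoundaryLoop (x : G) :
    p₂ (conjBoundaryLoop x) = boundaryClass (homologyClass x) := by
  set u := homologyClass x
  set t : G := α ^ u 0 * β ^ u 1 with ht
  have hxt : x * t⁻¹ ∈ G₂ := by
    rw [mem_commutator_iff, homologyClass_mul, homologyClass_inv, ht,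
      homologyClass_α_zpow_mul_β_zpow, add_neg_cancel]
  have hconj : conjBoundaryLoop x = ⟨x * t⁻¹, hxt⟩ * conjBoundaryLoop t * ⟨x * t⁻¹, hxt⟩⁻¹ := by
    ext
    simp only [conjBoundaryLoop, Subgroup.coe_mul, Subgroup.coe_inv]
    group
  rw [hconj, p₂_mul, p₂_mul, p₂_inv, add_comm, neg_add_cancel_left]
  rfl

/-- A word in `α` and `β` is a path in the grid `ℤ²`, on which `T̂` retracts. Its left component
counts, for each `u ∈ ℤ²`, the signed crossings of this path with the ray in the direction of `α`
that starts at the boundary component with index `u`; the ray meets only edges labelled `β`. -/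
def crossingHom : G →* Multiplicative ℤ ≀ᵣ Multiplicative (Fin 2 → ℤ) :=
  FreeGroup.lift ![
    ⟨1, Multiplicative.ofAdd (Pi.single 0 1)⟩,
    ⟨fun u => Multiplicative.ofAdd (if u.toAdd 1 = 0 ∧ u.toAdd 0 < 0 then 1 else 0),
      Multiplicative.ofAdd (Pi.single 1 1)⟩]

theorem regularWreathProduct_conj_left {D Q : Type*} [CommGroup D] [Group Q] {x y : D ≀ᵣ Q}
    (hy : y.right = 1) (q : Q) : (x * y * x⁻¹).left q = y.left (x.right⁻¹ * q) := by
  simp [hy, mul_right_comm]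

theorem crossingHom_right (g : G) : (crossingHom g).right = p₁ g := by
  refine DFunLike.congr_fun (f := RegularWreathProduct.rightHom.comp crossingHom) ?_ g
  ext i : 1
  fin_cases i <;> simp [crossingHom, p₁]

theorem crossingHom_right_of_mem {g : G} (hg : g ∈ G₂) : (crossingHom g).right = 1 := by
  rw [crossingHom_right, ← MonoidHom.mem_ker, ker_p₁]
  exact hg

theorem crossingHom_boundaryLoop_left (u : Multiplicative (Fin 2 → ℤ)) :
    (crossingHom boundaryLoop).left u = Multiplicative.ofAdd (if u.toAdd = 0 then 1 else 0) := by
  have hleft : (crossingHom boundaryLoop).left u = Multiplicative.ofAdd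
      ((if u.toAdd 1 = 0 ∧ u.toAdd 0 < 1 then 1 else 0) -
        (if u.toAdd 1 = 0 ∧ u.toAdd 0 < 0 then 1 else 0)) := by
    simp [crossingHom, boundaryLoop, α, β, ofAdd_sub, div_eq_mul_inv]
  have hzero : u.toAdd = 0 ↔ u.toAdd 0 = 0 ∧ u.toAdd 1 = 0 := by
    rw [funext_iff, Fin.forall_fin_two]
    rfl
  rw [hleft]
  congr 1
  grind

/-- The winding numbers around the boundary components of `T̂`, as functions on its homology. -/
def windingNumber : coverHomology →+ ((Fin 2 → ℤ) → ℤ) :=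
  MonoidHom.toAdditiveLeft <| Abelianization.lift
    { toFun a := Multiplicative.ofAdd fun u => ((crossingHom a).left (.ofAdd u)).toAdd
      map_one' := by
        rw [Subgroup.coe_one, map_one]
        rfl
      map_mul' a b := by
        simp only [Subgroup.coe_mul, map_mul, RegularWreathProduct.mul_left,
          crossingHom_right_of_mem a.2, inv_one, one_mul]
        rfl }

theorem windingNumber_boundaryClass (u : Fin 2 → ℤ) :
    windingNumber (boundaryClass u) = Pi.single u 1 := by
  ext v
  change ((crossingHom (_ * boundaryLoop * _⁻¹)).left (Multiplicative.ofAdd v)).toAdd = _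
  rw [map_mul, map_mul, map_inv,
    regularWreathProduct_conj_left (crossingHom_right_of_mem boundaryLoop_mem),
    crossingHom_boundaryLoop_left, crossingHom_right, Pi.single_apply]
  have hv : ((p₁ (α ^ u 0 * β ^ u 1))⁻¹ * Multiplicative.ofAdd v).toAdd = v - u := by
    change -homologyClass _ + v = _
    rw [homologyClass_α_zpow_mul_β_zpow, neg_add_eq_sub]
  simp only [hv, sub_eq_zero, toAdd_ofAdd]

theorem linearIndependent_boundaryClass : LinearIndependent ℤ boundaryClass := by
  have hcomp : windingNumber.toIntLinearMap ∘ boundaryClass = fun u => Pi.single u 1 :=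
    funext windingNumber_boundaryClass
  refine LinearIndependent.of_comp windingNumber.toIntLinearMap ?_
  rw [hcomp]
  exact Pi.linearIndependent_single_one _ _

theorem span_range_boundaryClass : Submodule.span ℤ (Set.range boundaryClass) = ⊤ := by
  rw [Submodule.eq_top_iff']
  intro v
  obtain ⟨g, rfl : p₂ g = v⟩ := QuotientGroup.mk_surjective v.toMul
  have hg' : g ∈ Subgroup.closure (Set.range conjBoundaryLoop) := by
    rw [closure_range_conjBoundaryLoop]
    exact Subgroup.mem_top g
  induction hg' using Subgroup.closure_induction with
  | mem _ hx =>
    obtain ⟨x, rfl⟩ := hx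
    rw [p₂_conjBoundaryLoop]
    exact Submodule.subset_span (Set.mem_range_self _)
  | one => exact zero_mem _
  | mul a b _ _ ha hb => exact add_mem ha hb
  | inv a _ ha => exact neg_mem ha

/-- The basis `𝓑` of `H₁(T̂; ℤ)`. -/
noncomputable def boundaryBasis : Module.Basis (Fin 2 → ℤ) ℤ coverHomology :=
  Module.Basis.mk linearIndependent_boundaryClass span_range_boundaryClass.ge

theorem boundaryBasis_apply (u : Fin 2 → ℤ) : boundaryBasis u = boundaryClass u :=
  Module.Basis.mk_apply _ _ u

/-- The coefficients of `p₂ g` with respect to the basis `𝓑`. -/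
noncomputable def boundaryCoeff (g : G₂) : (Fin 2 → ℤ) →₀ ℤ := boundaryBasis.repr (p₂ g)

theorem boundaryCoeff_one : boundaryCoeff 1 = 0 := map_zero boundaryBasis.repr

theorem boundaryCoeff_mul (a b : G₂) :
    boundaryCoeff (a * b) = boundaryCoeff a + boundaryCoeff b :=
  map_add boundaryBasis.repr (p₂ a) (p₂ b)

theorem boundaryCoeff_inv (a : G₂) : boundaryCoeff a⁻¹ = -boundaryCoeff a :=
  map_neg boundaryBasis.repr (p₂ a)

theorem boundaryCoeff_eq_zero_iff {a : G₂} : boundaryCoeff a = 0 ↔ (a : G) ∈ ⁅G₂, G₂⁆ := by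
  rw [← p₂_eq_zero_iff, boundaryCoeff, EmbeddingLike.map_eq_zero_iff]

theorem boundaryCoeff_conjBoundaryLoop (x : G) :
    boundaryCoeff (conjBoundaryLoop x) = Finsupp.single (homologyClass x) 1 := by
  rw [boundaryCoeff, p₂_conjBoundaryLoop, ← boundaryBasis_apply, Module.Basis.repr_self]

theorem boundaryCoeff_of_coe_eq_map {φ : G →* G} {c : G} {σ : (Fin 2 → ℤ) → Fin 2 → ℤ}
    (hφ : φ boundaryLoop = c * boundaryLoop * c⁻¹)
    (hσ : ∀ x, homologyClass (φ x * c) = σ (homologyClass x)) {a b : G₂} (hab : (b : G) = φ a) :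
    boundaryCoeff b = (boundaryCoeff a).mapDomain σ := by
  have hle : G₂.map φ ≤ G₂ :=
    (Subgroup.map_commutator ⊤ ⊤ φ).le.trans (Subgroup.commutator_mono le_top le_top)
  have hmaps (a : G₂) : φ a ∈ G₂ := hle (Subgroup.mem_map_of_mem φ a.2)
  let ψ : G₂ →* G₂ := (φ.comp G₂.subtype).codRestrict G₂ hmaps
  obtain rfl : b = ψ a := Subtype.ext hab
  have ha : a ∈ Subgroup.closure (Set.range conjBoundaryLoop) := by
    rw [closure_range_conjBoundaryLoop]
    exact Subgroup.mem_top a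
  clear hab
  induction ha using Subgroup.closure_induction with
  | mem _ hx =>
    obtain ⟨x, rfl⟩ := hx
    have hψ : ψ (conjBoundaryLoop x) = conjBoundaryLoop (φ x * c) := by
      ext
      change φ (x * boundaryLoop * x⁻¹) = _
      simp [conjBoundaryLoop, hφ, mul_assoc]
    rw [hψ, boundaryCoeff_conjBoundaryLoop, boundaryCoeff_conjBoundaryLoop, hσ,
      Finsupp.mapDomain_single]
  | one => simp [boundaryCoeff_one]
  | mul a b _ _ ha hb =>
    rw [map_mul, boundaryCoeff_mul, boundaryCoeff_mul, ha, hb, Finsupp.mapDomain_add]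
  | inv a _ ha =>
    rw [map_inv, boundaryCoeff_inv, boundaryCoeff_inv, ha]
    exact (map_neg (Finsupp.mapDomain.addMonoidHom (M := ℤ) σ) _).symm

theorem boundaryCoeff_of_coe_eq_conj (x : G) {a b : G₂} (hab : (b : G) = x * a * x⁻¹) :
    boundaryCoeff b = (boundaryCoeff a).mapDomain (· + homologyClass x) :=
  boundaryCoeff_of_coe_eq_map (φ := (MulAut.conj x).toMonoidHom) rfl
    (fun y => by simp [homologyClass_mul, add_comm]) hab

/-! ### The constructed cone -/

section ConstructedCone

variable {h : MulAut G} {Q₁ Q : Set (Fin 2 → ℤ)} {R : Set (bundleGroup h)}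

theorem hasLeadingTerm_iff [IsStrictTotalOrder (Fin 2 → ℤ) (prec Q)] {v : coverHomology}
    {w : Fin 2 → ℤ} {k : ℤ} :
    HasLeadingTerm Q v w k ↔
      IsLeadingIndex (prec Q) (boundaryBasis.repr v) w ∧ boundaryBasis.repr v w = k := by
  have hsum (c : (Fin 2 → ℤ) →₀ ℤ) :
      v = c.sum (fun u a => a • boundaryClass u) ↔ boundaryBasis.repr v = c := by
    rw [← LinearEquiv.eq_symm_apply, Module.Basis.repr_symm_apply,
      Finsupp.linearCombination_apply]
    simp only [boundaryBasis_apply]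
  simp only [HasLeadingTerm, hsum, exists_eq_left']
  constructor
  · rintro ⟨rfl, hw, hlt⟩
    refine ⟨⟨hw, fun u hu => ?_⟩, rfl⟩
    by_contra hne
    rcases eq_or_ne u w with rfl | huw
    · exact irrefl _ hu
    · exact asymm hu (hlt u hne huw)
  · rintro ⟨hw, rfl⟩
    exact ⟨rfl, hw.1, fun u hu huw => (hw.eq_or_rel hu).resolve_left huw.symm⟩

theorem mem_leadCone_iff [IsStrictTotalOrder (Fin 2 → ℤ) (prec Q)] {g : G₂} :
    p₂ g ∈ leadCone Q ↔ LeadPos (prec Q) (boundaryCoeff g) := by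
  simp only [leadCone, Set.mem_ofPred_eq, hasLeadingTerm_iff]
  constructor
  · rintro ⟨w, _, ⟨hw, rfl⟩, hpos⟩
    exact ⟨w, hpos, hw.2⟩
  · rintro ⟨w, hpos, hzero⟩
    exact ⟨w, _, ⟨⟨hpos.ne', hzero⟩, rfl⟩, hpos⟩

theorem isConeModulo_leadCone [IsStrictTotalOrder (Fin 2 → ℤ) (prec Q)] :
    IsConeModulo G₂ ⁅G₂, G₂⁆ {g | ∃ hg : g ∈ G₂, p₂ ⟨g, hg⟩ ∈ leadCone Q} := by
  simp only [mem_leadCone_iff]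
  refine
    { le := Subgroup.commutator_le_left G₂ G₂
      subset := fun _ hg => hg.1
      mul_mem := ?_
      mul_mem_right := ?_
      notMem := ?_
      exhaust := ?_
      conj_mem := ?_ }
  · rintro a ⟨ha, ha'⟩ b ⟨hb, hb'⟩
    exact ⟨mul_mem ha hb, boundaryCoeff_mul ⟨a, ha⟩ ⟨b, hb⟩ ▸ ha'.add hb'⟩
  · rintro a ⟨ha, ha'⟩ n hn
    have hn' : n ∈ G₂ := Subgroup.commutator_le_left G₂ G₂ hn
    refine ⟨mul_mem ha hn', ?_⟩
    have hzero : boundaryCoeff ⟨n, hn'⟩ = 0 := boundaryCoeff_eq_zero_iff.mpr hn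
    rwa [← MulMemClass.mk_mul_mk _ a n ha hn', boundaryCoeff_mul, hzero, add_zero]
  · rintro a ⟨ha, ha'⟩ hmem
    have hzero : boundaryCoeff ⟨a, ha⟩ = 0 := boundaryCoeff_eq_zero_iff.mpr hmem
    exact not_leadPos_zero (hzero ▸ ha')
  · intro a ha
    rcases leadPos_or_neg (r := prec Q) (boundaryCoeff ⟨a, ha⟩) with h | h | h
    · exact Or.inl ⟨ha, h⟩
    · exact Or.inr (Or.inl ⟨inv_mem ha, boundaryCoeff_inv ⟨a, ha⟩ ▸ h⟩)
    · exact Or.inr (Or.inr (boundaryCoeff_eq_zero_iff.mp h))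
  · rintro a ⟨ha, ha'⟩ x
    have hmem : x * a * x⁻¹ ∈ G₂ := Subgroup.Normal.conj_mem inferInstance a ha x
    have hcoeff : boundaryCoeff ⟨x * a * x⁻¹, hmem⟩ =
        (boundaryCoeff ⟨a, ha⟩).mapDomain (· + homologyClass x) :=
      boundaryCoeff_of_coe_eq_conj x rfl
    refine ⟨hmem, ?_⟩
    rw [hcoeff]
    exact ha'.mapDomain fun u v huv => (prec_add_right_iff _).mpr huv

theorem isPositiveCone_constructedCone [IsStrictTotalOrder (Fin 2 → ℤ) (prec Q)]
    (hQ₁ : IsPositiveCone (Multiplicative.toAdd ⁻¹' Q₁)) (hR : IsPositiveCone R) :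
    IsPositiveCone (constructedCone h Q₁ Q R) := by
  have hQ₁' : IsConeModulo ⊤ G₂ (p₁ ⁻¹' (Multiplicative.toAdd ⁻¹' Q₁)) :=
    ker_p₁ ▸ hQ₁.isConeModulo_ker p₁
  have hR' : IsConeModulo ⁅G₂, G₂⁆ ⊥ (restCone h R) :=
    (hR.preimage SemidirectProduct.inl_injective).isConeModulo_inter ⁅G₂, G₂⁆
  exact (hQ₁'.union (isConeModulo_leadCone.union hR')).isPositiveCone

theorem IsPositiveCone.inl_map_mem (hR : IsPositiveCone R) {g : G}
    (hg : (SemidirectProduct.inl g : bundleGroup h) ∈ R) :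
    (SemidirectProduct.inl (h g) : bundleGroup h) ∈ R := by
  have hconj := SemidirectProduct.inl_aut (φ := zpowersHom (MulAut G) h) (.ofAdd 1) g
  rw [zpowersHom_apply, toAdd_ofAdd, zpow_one, map_inv] at hconj
  exact hconj ▸ hR.conj_mem hg _

theorem map_mem_constructedCone [IsStrictTotalOrder (Fin 2 → ℤ) (prec Q)]
    (hγ : IsConj boundaryLoop (h boundaryLoop)) (hQ₁ : ∀ u ∈ Q₁, (hPlus h).mulVec u ∈ Q₁)
    (hQ : ∀ u ∈ Q, (hPlus h).mulVec u ∈ Q) (hR : IsPositiveCone R) :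
    ∀ g ∈ constructedCone h Q₁ Q R, h g ∈ constructedCone h Q₁ Q R := by
  rintro g (hg | ⟨hg, hlead⟩ | ⟨hg, hgR⟩)
  · exact Or.inl (homologyClass_map h g ▸ hQ₁ _ hg)
  · obtain ⟨c, hc⟩ := isConj_iff.mp hγ
    have hmem : h g ∈ G₂ := by
      rw [mem_commutator_iff, homologyClass_map, mem_commutator_iff.mp hg, Matrix.mulVec_zero]
    have hcoeff : boundaryCoeff ⟨h g, hmem⟩ = (boundaryCoeff ⟨g, hg⟩).mapDomain
        fun u => (hPlus h).mulVec u + homologyClass c :=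
      boundaryCoeff_of_coe_eq_map (φ := h.toMonoidHom) hc.symm
        (fun x => (homologyClass_mul _ _).trans (congrArg (· + _) (homologyClass_map h x))) rfl
    refine Or.inr (Or.inl ⟨hmem, mem_leadCone_iff.mpr ?_⟩)
    rw [hcoeff]
    refine (mem_leadCone_iff.mp hlead).mapDomain fun u v huv => ?_
    rw [prec_add_right_iff, prec, ← Matrix.mulVec_sub]
    exact hQ _ huv
  · refine Or.inr (Or.inr ⟨?_, hR.inl_map_mem hgR⟩)
    exact (Subgroup.characteristic_iff_map_le.mp inferInstance h) (Subgroup.mem_map_of_mem _ hg)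

end ConstructedCone

/-! ### The convex subgroups of `G₂` -/

section ConvexSubgroups

variable {h : MulAut G} {Q₁ Q : Set (Fin 2 → ℤ)} {R : Set (bundleGroup h)}

/-- The subgroup `C_γ` of `G₂`, for `γ` with index `u`: the elements whose image in `H₁(T̂; ℤ)` has
no boundary component above `γ` in its support. -/
def vanishingAbove (Q : Set (Fin 2 → ℤ)) (u : Fin 2 → ℤ) : Subgroup G₂ where
  carrier := {g | ∀ v, prec Q u v → boundaryCoeff g v = 0}
  one_mem' v _ := by simp [boundaryCoeff_one]
  mul_mem' {a b} ha hb v hv := by simp [boundaryCoeff_mul, ha v hv, hb v hv]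
  inv_mem' {a} ha v hv := by simp [boundaryCoeff_inv, ha v hv]

theorem mem_vanishingAbove {u : Fin 2 → ℤ} {g : G₂} :
    g ∈ vanishingAbove Q u ↔ ∀ v, prec Q u v → boundaryCoeff g v = 0 := Iff.rfl

theorem coe_vanishingAbove [IsStrictTotalOrder (Fin 2 → ℤ) (prec Q)] (u : Fin 2 → ℤ) :
    (vanishingAbove Q u : Set G₂) = convexPiece Q u := by
  ext g
  have hpiece : g ∈ convexPiece Q u ↔
      p₂ g = 0 ∨ ∃ w, IsLeadingIndex (prec Q) (boundaryCoeff g) w ∧ ¬ prec Q u w := by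
    have hle (w : Fin 2 → ℤ) : w = u ∨ prec Q w u ↔ ¬ prec Q u w := by
      rcases trichotomous_of (prec Q) w u with hw | rfl | hw
      · simp [hw, asymm hw]
      · simp [irrefl]
      · simp [hw, asymm hw, (ne_of_irrefl hw).symm]
    simp [convexPiece, hasLeadingTerm_iff, hle, boundaryCoeff]
  rw [SetLike.mem_coe, mem_vanishingAbove, hpiece]
  constructor
  · intro hg
    refine or_iff_not_imp_left.mpr fun hne => ?_
    obtain ⟨w, hw⟩ := exists_isLeadingIndex (r := prec Q) (f := boundaryCoeff g)
      (by simpa [boundaryCoeff] using hne)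
    exact ⟨w, hw, hw.forall_eq_zero_iff.mp hg⟩
  · rintro (hzero | ⟨w, hw, huw⟩)
    · simp [boundaryCoeff, hzero]
    · exact hw.forall_eq_zero_iff.mpr huw

theorem exists_mem_vanishingAbove [IsStrictOrder (Fin 2 → ℤ) (prec Q)] (g : G₂) :
    ∃ u, g ∈ vanishingAbove Q u := by
  rcases eq_or_ne (boundaryCoeff g) 0 with hg | hg
  · exact ⟨0, fun v _ => by simp [hg]⟩
  · exact (exists_isLeadingIndex hg).imp fun _ hw => hw.2

theorem isLeadingIndex_boundaryCoeff_conjBoundaryLoop [Std.Irrefl (prec Q)] (x : G) :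
    IsLeadingIndex (prec Q) (boundaryCoeff (conjBoundaryLoop x)) (homologyClass x) := by
  rw [boundaryCoeff_conjBoundaryLoop]
  exact ⟨by simp, fun u hu => Finsupp.single_eq_of_ne (ne_of_irrefl hu).symm⟩

theorem conjBoundaryLoop_mem_vanishingAbove_iff [IsStrictTotalOrder (Fin 2 → ℤ) (prec Q)]
    {x : G} {u : Fin 2 → ℤ} :
    conjBoundaryLoop x ∈ vanishingAbove Q u ↔ ¬ prec Q u (homologyClass x) :=
  (isLeadingIndex_boundaryCoeff_conjBoundaryLoop x).forall_eq_zero_iff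

theorem vanishingAbove_lt_vanishingAbove [IsStrictTotalOrder (Fin 2 → ℤ) (prec Q)]
    {u v : Fin 2 → ℤ} (huv : prec Q u v) : vanishingAbove Q u < vanishingAbove Q v := by
  refine SetLike.lt_iff_le_and_exists.mpr
    ⟨fun g hg w hw => hg w (_root_.trans huv hw), conjBoundaryLoop (α ^ v 0 * β ^ v 1), ?_⟩
  simp only [conjBoundaryLoop_mem_vanishingAbove_iff, homologyClass_α_zpow_mul_β_zpow, not_not]
  exact ⟨irrefl v, huv⟩

theorem mem_constructedCone_iff_leadPos [IsStrictTotalOrder (Fin 2 → ℤ) (prec Q)]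
    (hQ₁ : IsPositiveCone (Multiplicative.toAdd ⁻¹' Q₁)) {g : G₂} (hg : boundaryCoeff g ≠ 0) :
    (g : G) ∈ constructedCone h Q₁ Q R ↔ LeadPos (prec Q) (boundaryCoeff g) := by
  constructor
  · rintro (hg₁ | ⟨_, hg₂⟩ | ⟨hg₃, -⟩)
    · rw [mem_commutator_iff.mp g.2] at hg₁
      exact absurd hg₁ hQ₁.one_notMem
    · exact mem_leadCone_iff.mp hg₂
    · exact absurd (boundaryCoeff_eq_zero_iff.mpr hg₃) hg
  · exact fun hlead => Or.inr (Or.inl ⟨g.2, mem_leadCone_iff.mpr hlead⟩)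

theorem isPositiveCone_restrictG₂ {P : Set G} (hP : IsPositiveCone P) :
    IsPositiveCone (restrictG₂ P) :=
  hP.preimage G₂.subtype_injective

theorem isConvexSubgroup_vanishingAbove [IsStrictTotalOrder (Fin 2 → ℤ) (prec Q)]
    (hQ₁ : IsPositiveCone (Multiplicative.toAdd ⁻¹' Q₁)) (hR : IsPositiveCone R)
    (u : Fin 2 → ℤ) :
    IsConvexSubgroup (restrictG₂ (constructedCone h Q₁ Q R)) (vanishingAbove Q u) := by
  have hne {g : G₂} (hg : g ∉ vanishingAbove Q u) : boundaryCoeff g ≠ 0 :=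
    fun hzero => hg fun v _ => by simp [hzero]
  rw [isConvexSubgroup_iff (isPositiveCone_restrictG₂ (isPositiveCone_constructedCone hQ₁ hR))]
  intro c hc a ha haC
  have hcaC : c * a ∉ vanishingAbove Q u := fun hca => haC ((mul_mem_cancel_left hc).mp hca)
  have hlead := (mem_constructedCone_iff_leadPos hQ₁ (hne haC)).mp ha
  refine (mem_constructedCone_iff_leadPos hQ₁ (hne hcaC)).mpr ?_
  rw [boundaryCoeff_mul]
  exact hlead.add_of_vanishing_above hc haC

theorem conjBoundaryLoop_mem_constructedCone [IsStrictTotalOrder (Fin 2 → ℤ) (prec Q)] (x : G) :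
    conjBoundaryLoop x ∈ restrictG₂ (constructedCone h Q₁ Q R) := by
  have hlead := isLeadingIndex_boundaryCoeff_conjBoundaryLoop (Q := Q) x
  refine Or.inr (Or.inl ⟨(conjBoundaryLoop x).2, mem_leadCone_iff.mpr ⟨_, ?_, hlead.2⟩⟩)
  simp [boundaryCoeff_conjBoundaryLoop]

end ConvexSubgroups

/-! ### The lower central series -/

theorem degree_boundaryCoeff_conj (x : G) {a b : G₂} (hab : (b : G) = x * a * x⁻¹) :
    (boundaryCoeff b).degree = (boundaryCoeff a).degree := by
  rw [boundaryCoeff_of_coe_eq_conj x hab, Finsupp.degree_mapDomain]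

theorem degree_boundaryCoeff_eq_zero {g : G₂}
    (hg : (g : G) ∈ (⊤ : Subgroup G).lowerCentralSeries 2) : (boundaryCoeff g).degree = 0 := by
  let S : Subgroup G₂ :=
    { carrier := {a | (boundaryCoeff a).degree = 0}
      one_mem' := by simp [boundaryCoeff_one]
      mul_mem' := fun {a b} ha hb => by simp_all [boundaryCoeff_mul]
      inv_mem' := fun {a} ha => by simp_all [boundaryCoeff_inv] }
  suffices hle : (⊤ : Subgroup G).lowerCentralSeries 2 ≤ S.map G₂.subtype from
    (Subgroup.mem_map_iff_mem G₂.subtype_injective).mp (hle hg)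
  rw [Subgroup.lowerCentralSeries_succ, Subgroup.top_lowerCentralSeries_one,
    Subgroup.commutator_le]
  intro a ha x _
  have hconj : x * a⁻¹ * x⁻¹ ∈ G₂ := Subgroup.Normal.conj_mem inferInstance _ (inv_mem ha) x
  refine ⟨⟨a, ha⟩ * ⟨x * a⁻¹ * x⁻¹, hconj⟩, ?_, by simp [commutatorElement_def, mul_assoc]⟩
  change (boundaryCoeff _).degree = 0
  rw [boundaryCoeff_mul, map_add,
    degree_boundaryCoeff_conj x (a := ⟨a, ha⟩⁻¹) (b := ⟨_, hconj⟩) rfl, boundaryCoeff_inv,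
    map_neg, add_neg_cancel]

theorem boundaryLoop_notMem_lowerCentralSeries :
    boundaryLoop ∉ (⊤ : Subgroup G).lowerCentralSeries 2 := by
  intro hmem
  have hdegree : (boundaryCoeff (conjBoundaryLoop 1)).degree = 0 :=
    degree_boundaryCoeff_eq_zero (by simpa [conjBoundaryLoop] using hmem)
  simp [boundaryCoeff_conjBoundaryLoop] at hdegree

theorem conj_boundaryLoop_mul_inv_mem_lowerCentralSeries (x : G) :
    x * boundaryLoop * x⁻¹ * boundaryLoop⁻¹ ∈ (⊤ : Subgroup G).lowerCentralSeries 2 := by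
  rw [Subgroup.lowerCentralSeries_succ, Subgroup.top_lowerCentralSeries_one,
    Subgroup.commutator_comm]
  exact Subgroup.commutator_mem_commutator (Subgroup.mem_top x) boundaryLoop_mem

theorem not_isStandard_constructedCone {h : MulAut G} {Q₁ Q : Set (Fin 2 → ℤ)}
    {R : Set (bundleGroup h)} (hQ₁ : IsPositiveCone (Multiplicative.toAdd ⁻¹' Q₁))
    (hQ : IsPositiveCone (Multiplicative.toAdd ⁻¹' Q)) (hR : IsPositiveCone R) :
    ¬ IsStandard (constructedCone h Q₁ Q R) := by
  have := isStrictTotalOrder_prec hQ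
  intro hstd
  obtain ⟨v, hv⟩ := exists_prec hQ 0
  set x : G := α ^ v 0 * β ^ v 1
  have hxv : homologyClass x = v := homologyClass_α_zpow_mul_β_zpow v
  have hP := isPositiveCone_restrictG₂ (isPositiveCone_constructedCone (Q := Q) hQ₁ hR)
  have hγ : conjBoundaryLoop 1 ∈ vanishingAbove Q 0 := by
    simp [conjBoundaryLoop_mem_vanishingAbove_iff, homologyClass_one, irrefl]
  have hγx : conjBoundaryLoop x ∉ vanishingAbove Q 0 := by
    simpa [conjBoundaryLoop_mem_vanishingAbove_iff, hxv] using hv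
  have hle : (conjBoundaryLoop 1)⁻¹ * (conjBoundaryLoop 1)⁻¹ * conjBoundaryLoop x ∈
      restrictG₂ (constructedCone h Q₁ Q R) :=
    (isConvexSubgroup_iff hP).mp (isConvexSubgroup_vanishingAbove hQ₁ hR 0) _
      (mul_mem (inv_mem hγ) (inv_mem hγ)) _ (conjBoundaryLoop_mem_constructedCone x) hγx
  have hlt := hP.mul_mem_comm (mul_assoc (conjBoundaryLoop 1)⁻¹ _ _ ▸ hle)
  refine boundaryLoop_notMem_lowerCentralSeries (hstd 2 1 (one_mem _) _
    (conj_boundaryLoop_mul_inv_mem_lowerCentralSeries x) boundaryLoop ?_ ?_)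
  · simpa [coneLT, restrictG₂, conjBoundaryLoop] using
      conjBoundaryLoop_mem_constructedCone (h := h) (Q₁ := Q₁) (Q := Q) (R := R) 1
  · simpa [coneLT, restrictG₂, conjBoundaryLoop, mul_assoc] using hlt

end PuncturedTorusBundle

theorem corollary4_general {h : MulAut G} (hγ : IsConj boundaryLoop (h boundaryLoop))
    {Q₁ Q : Set (Fin 2 → ℤ)} (hQ₁ : IsPositiveCone (Multiplicative.toAdd ⁻¹' Q₁))
    (hQ : IsPositiveCone (Multiplicative.toAdd ⁻¹' Q))
    (hQ₁h : ∀ u ∈ Q₁, (hPlus h).mulVec u ∈ Q₁) (hQh : ∀ u ∈ Q, (hPlus h).mulVec u ∈ Q)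
    {R : Set (bundleGroup h)} (hR : IsPositiveCone R)
    {P : Set G} (hP : P = constructedCone h Q₁ Q R) :
    IsPositiveCone P ∧
    (∃ P' : Set (bundleGroup h), IsPositiveCone P' ∧
      ∀ g : G, (SemidirectProduct.inl g : bundleGroup h) ∈ P' ↔ g ∈ P) ∧
    ¬ IsStandard P ∧
    (¬ ∃ C : Subgroup G₂, IsMaximalConvexSubgroup (restrictG₂ P) C) ∧
    (∃ C : (Fin 2 → ℤ) → Subgroup G₂,
      (∀ u, (C u : Set G₂) = convexPiece Q u) ∧
      (∀ u, IsConvexSubgroup (restrictG₂ P) (C u)) ∧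
      (∀ u v, prec Q u v → C u < C v) ∧
      (∀ u, C u < ⊤) ∧
      (⋃ u, (C u : Set G₂)) = Set.univ) := by
  subst hP
  have := isStrictTotalOrder_prec hQ
  have hcone := isPositiveCone_constructedCone (Q := Q) hQ₁ hR
  have hconvex := isConvexSubgroup_vanishingAbove (Q := Q) hQ₁ hR
  have hlt (u) : ∃ v, vanishingAbove Q u < vanishingAbove Q v :=
    (exists_prec hQ u).imp fun v huv => vanishingAbove_lt_vanishingAbove huv
  refine ⟨hcone, ?extension, not_isStandard_constructedCone hQ₁ hQ hR, ?noMaximal,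
    vanishingAbove Q, coe_vanishingAbove, hconvex,
    fun u v huv => vanishingAbove_lt_vanishingAbove huv, ?proper, ?cover⟩
  case extension =>
    exact exists_isPositiveCone_semidirectProduct_zpowersHom hcone
      (map_mem_constructedCone hγ hQ₁h hQh hR)
  case noMaximal =>
    exact not_exists.mpr <| not_isMaximalConvexSubgroup_of_exhaustion
      (isPositiveCone_restrictG₂ hcone) hconvex hlt exists_mem_vanishingAbove
  case proper =>
    exact fun u => (hlt u).elim fun v huv => huv.trans_le le_top
  case cover =>
    exact Set.eq_univ_of_forall fun g => Set.mem_iUnion.mpr (exists_mem_vanishingAbove g)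

theorem corollary4
    (h : MulAut G) (hh : IsUntwistedHyperbolic h)
    (lam : ℝ) (E : Module.Basis (Fin 2) ℝ (Fin 2 → ℝ)) (hE : IsEigenbasis h lam E)
    (i₁ i₂ : Fin 2) (s₁ s₂ : ℤˣ)
    (R : Set (bundleGroup h)) (hR : IsPositiveCone R)
    (Q : Set (Fin 2 → ℤ)) (hQ : Q = eigenCone E i₂ s₂)
    (P : Set G) (hP : P = constructedCone h (eigenCone E i₁ s₁) Q R) :
    -- `P` is a positive cone of `G`, it extends to one of `π₁(M)`, and it is not standard
    IsPositiveCone P ∧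
    (∃ P' : Set (bundleGroup h), IsPositiveCone P' ∧
      ∀ g : G, (SemidirectProduct.inl g : bundleGroup h) ∈ P' ↔ g ∈ P) ∧
    ¬ IsStandard P ∧
    -- `G₂` has no maximal convex subgroup
    (¬ ∃ C : Subgroup G₂, IsMaximalConvexSubgroup (restrictG₂ P) C) ∧
    -- `G₂` is the increasing union of the proper convex subgroups `C_γ`
    (∃ C : (Fin 2 → ℤ) → Subgroup G₂,
      (∀ u, (C u : Set G₂) = convexPiece Q u) ∧
      (∀ u, IsConvexSubgroup (restrictG₂ P) (C u)) ∧
      (∀ u v, prec Q u v → C u < C v) ∧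
      (∀ u, C u < ⊤) ∧
      (⋃ u, (C u : Set G₂)) = Set.univ) := by
  subst hQ hP
  exact corollary4_general (by rw [hh.fixes_boundary])
    (hE.isPositiveCone_eigenCone hh.two_lt_trace i₁ s₁)
    (hE.isPositiveCone_eigenCone hh.two_lt_trace i₂ s₂)
    (fun _ => hE.mulVec_mem_eigenCone hh.two_lt_trace i₁ s₁)
    (fun _ => hE.mulVec_mem_eigenCone hh.two_lt_trace i₂ s₂) hR rfl
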